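/- Let $d\ge 1$ be an integer. For every even integer $L\ge 2$ let $V=L^d$, and consider spinless fermions on the $d$-dimensional periodic square lattice $\mathcal L=\{0,\dots,L-1\}^d$ with $V$ sites, with fermionic annihilation and creation operators $f_r,f_r^\dagger$ ($r\in\mathcal L$) acting on Fock space, and the nearest-neighbour hopping Hamiltonian of hopping strength one $$H=\sum_{r,s\in\mathcal L} f_r^\dagger M_{r,s} f_s,\qquad M=\sum_{k=0}^{d-1}\mathbb 1^{\otimes k}\otimes M^{(1)}\otimes \mathbb 1^{\otimes(d-k-1)},$$ where $M^{(1)}\in\mathbb R^{L\times L}$ has entries $M^{(1)}_{a,b}=-1$ if $a-b\equiv\pm1 \pmod L$ and $M^{(1)}_{a,b}=0$ otherwise. Let $c=(c_j)$ be the collection of all $2V$ operators $f_r$, $f_r^\dagger$, let $h=\tfrac12(M\oplus -M)$, where the first summand acts on the indices of the $f_r$ and the second on the indices of the $f_r^\dagger$, and let $W(t)=\mathrm e^{-2\mathrm i t h}$. Then $H=\sum_{j,k}c_j^\dagger h_{j,k}c_k$, and $W$ is the propagator of the model, i.e. $\mathrm e^{\mathrm iHt}c_j\,\mathrm e^{-\mathrm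 iHt}=\sum_{k}W_{j,k}(t)\,c_k$ for all $j$ and all $t\in\mathbb R$. Moreover, there is a constant $C_{\mathrm{Trans}}>0$, depending on $d$ but not on $V$, such that for all such $L$, all $t\in(0,V^{6/(7d)}]$ and all indices $j,k$, $$|W_{j,k}(t)|\le C_{\mathrm{Trans}}\,t^{-d/3}.$$ -/

import Mathlib

open scoped Matrix

noncomputable section

namespace FermionHopping

/-- Sites of the periodic lattice of side length `L` in dimension `d`; there are `V = L ^ d`. -/
abbrev Site (d L : ℕ) : Type := Fin d → Fin L

/-- The position of a site in a fixed enumeration of all `L ^ d` sites. -/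
def siteNumber {d L : ℕ} (r : Site d L) : Fin (L ^ d) := finFunctionFinEquiv r

/-- Operators on the fermionic Fock space over the lattice, written as matrices in the
occupation number basis: a basis vector is the set of occupied sites. -/
abbrev FockOp (d L : ℕ) : Type := Matrix (Finset (Site d L)) (Finset (Site d L)) ℂ

/-- The annihilation operator `f_r`. It sends the basis vector of `T` to `0` if `r ∉ T`, and
otherwise to `(-1) ^ #{s ∈ T | s comes before r}` times the basis vector of `T \ {r}`. -/
def annihilation {d L : ℕ} (r : Site d L) : FockOp d L :=
  Matrix.of fun S T =>
    if r ∈ T ∧ S = T.erase r then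
      (-1 : ℂ) ^ (T.filter fun s => siteNumber s < siteNumber r).card
    else 0

/-- The creation operator `f_r†`, the adjoint of `f_r`. -/
def creation {d L : ℕ} (r : Site d L) : FockOp d L := (annihilation r)ᴴ

/-- The index set of the `2 V` mode operators: `(r, 0)` stands for `f_r`, `(r, 1)` for `f_r†`. -/
abbrev ModeIndex (d L : ℕ) : Type := Site d L × Fin 2

/-- The collection `c` of all annihilation and creation operators. -/
def modeOp {d L : ℕ} (j : ModeIndex d L) : FockOp d L :=
  if j.2 = 0 then annihilation j.1 else creation j.1

/-- The one-dimensional periodic nearest-neighbour coupling matrix `M⁽¹⁾`: entry `-1` between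
cyclic neighbours, `0` elsewhere. -/
def hopping1D (L : ℕ) : Matrix (Fin L) (Fin L) ℝ :=
  Matrix.of fun a b =>
    if (b : ℕ) = ((a : ℕ) + 1) % L ∨ (a : ℕ) = ((b : ℕ) + 1) % L then -1 else 0

/-- The `d`-dimensional coupling matrix: the sum over directions `i` of the tensor product with
factor `M⁽¹⁾` in direction `i` and the identity in all other directions. -/
def hopping (d L : ℕ) : Matrix (Site d L) (Site d L) ℝ :=
  Matrix.of fun r s =>
    ∑ i : Fin d, hopping1D L (r i) (s i) *
      ∏ l ∈ Finset.univ.erase i, (1 : Matrix (Fin L) (Fin L) ℝ) (r l) (s l)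

/-- The hopping Hamiltonian `H = ∑ f_r† M_{r,s} f_s`. -/
def hamiltonian (d L : ℕ) : FockOp d L :=
  ∑ r : Site d L, ∑ s : Site d L,
    (hopping d L r s : ℂ) • (creation r * annihilation s)

/-- Heisenberg evolution `A(t) = exp(i H t) A exp(-i H t)` under the hopping Hamiltonian. -/
def heisenberg {d L : ℕ} (t : ℝ) (A : FockOp d L) : FockOp d L :=
  NormedSpace.exp ((Complex.I * (t : ℂ)) • hamiltonian d L) * A *
    NormedSpace.exp ((-(Complex.I * (t : ℂ))) • hamiltonian d L)

/-- The coupling matrix `h = (1/2) (M ⊕ -M)` of the Hamiltonian written as a quadratic form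
`∑ c_j† h_{j,k} c_k` in all mode operators. -/
def coupling (d L : ℕ) : Matrix (ModeIndex d L) (ModeIndex d L) ℂ :=
  Matrix.blockDiagonal
    ![(1 / 2 : ℂ) • (hopping d L).map Complex.ofReal,
      -((1 / 2 : ℂ) • (hopping d L).map Complex.ofReal)]

/-- The propagator `W(t) = exp(-2 i t h)`. -/
def propagator (d L : ℕ) (t : ℝ) : Matrix (ModeIndex d L) (ModeIndex d L) ℂ :=
  NormedSpace.exp ((-(2 * Complex.I * (t : ℂ))) • coupling d L)

end FermionHopping

end

/-! The algebraic half is the canonical anticommutation relations: with Jordan–Wigner signs they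
make the commutator of `hamiltonian` with each mode operator linear in the mode operators
(`commutator_modeOp`). Conjugation by the exponential therefore acts on the modes through a matrix
exponential, which is the propagator.

For the decay, plane waves diagonalise the hopping matrix and each propagator block factorises over
the directions (`exp_smul_hopping_apply`). What remains is a one-dimensional sum of `L` phases `exp
(i (ν k + 2 t cos (2 π k / L)))`, which must be `O(L / T)` with `T ^ 3 = t`; this is a discrete
Bessel function at a degenerate stationary point.

The sum is bounded without comparison to an integral (`norm_sum_exp_cos_le`). With phase increments
`2 x`, one has `1 / (exp (2 i x) - 1) = -(1 + i cot x) / 2`, so each term is a difference of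
consecutive terms times a cotangent factor, and summation by parts leaves the supremum and the
variation of the cotangent. Truncating the cotangent at `|x| < a` makes both `O(1 / a)`, and the
truncated indices are counted trivially. Here `x = ν / 2 - β sin θ` with `β` of order `T ^ 3 / L`.
Since the sine is at worst quadratic at its turning points, `|x| < a` holds for `O(L √(a / β) + 1)`
indices. The choice `a = T / L` gives `O(L / T)` for every contribution.

The condition `t ≤ L ^ (6/7)` gives `8 t ≤ L` for large `L`, which keeps the increments in `[-3π/2,
3π/2]`, where the cotangent has its only pole at `x = 0`. Small `L` and small `t` follow from
unitarity. -/

noncomputable section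
-- Jordan–Wigner signs and the canonical anticommutation relations.
namespace FermionHopping

/-- The Jordan–Wigner sign: the parity of the number of occupied sites before `r`. -/
def jwSign {d L : ℕ} (r : Site d L) (T : Finset (Site d L)) : ℂ :=
  (-1 : ℂ) ^ (T.filter fun s => siteNumber s < siteNumber r).card

variable {d L : ℕ}

lemma jwSign_mul_self (r : Site d L) (T : Finset (Site d L)) : jwSign r T * jwSign r T = 1 := by
  simp [jwSign, ← mul_pow]

lemma star_jwSign (r : Site d L) (T : Finset (Site d L)) : star (jwSign r T) = jwSign r T := by
  simp [jwSign]

lemma jwSign_insert {r s : Site d L} {T : Finset (Site d L)} (hs : s ∉ T) :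
    jwSign r (insert s T) = (if siteNumber s < siteNumber r then -1 else 1) * jwSign r T := by
  unfold jwSign
  rw [Finset.filter_insert]
  split_ifs with h
  · rw [Finset.card_insert_of_notMem (by simp [hs]), pow_succ]; ring
  · simp

lemma jwSign_erase {r s : Site d L} {T : Finset (Site d L)} (hs : s ∈ T) :
    jwSign r (T.erase s) = (if siteNumber s < siteNumber r then -1 else 1) * jwSign r T := by
  have h := jwSign_insert (r := r) (Finset.notMem_erase s T)
  rw [Finset.insert_erase hs] at h
  rw [h, ← mul_assoc]
  split_ifs <;> simp

lemma siteNumber_injective : Function.Injective (siteNumber : Site d L → Fin (L ^ d)) :=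
  finFunctionFinEquiv.injective

lemma annihilation_apply (r : Site d L) (S T : Finset (Site d L)) :
    annihilation r S T = if r ∈ T ∧ S = T.erase r then jwSign r T else 0 := rfl

lemma creation_apply (r : Site d L) (S T : Finset (Site d L)) :
    creation r S T = if r ∈ S ∧ T = S.erase r then jwSign r S else 0 := by
  rw [creation, Matrix.conjTranspose_apply, annihilation_apply]
  split_ifs <;> simp [star_jwSign, *]

/-- Each column of a mode operator has at most one nonzero entry, so right multiplication only
relabels and signs columns. Products of two mode operators can then be compared entrywise. -/
lemma mul_annihilation_apply (A : FockOp d L) (r : Site d L) (S T : Finset (Site d L)) :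
    (A * annihilation r) S T = if r ∈ T then A S (T.erase r) * jwSign r T else 0 := by
  rw [Matrix.mul_apply]
  simp only [annihilation_apply]
  by_cases h : r ∈ T <;> simp [h]

lemma mul_creation_apply (A : FockOp d L) (r : Site d L) (S T : Finset (Site d L)) :
    (A * creation r) S T = if r ∈ T then 0 else A S (insert r T) * jwSign r T := by
  rw [Matrix.mul_apply]
  simp only [creation_apply]
  by_cases h : r ∈ T
  · rw [if_pos h]
    refine Finset.sum_eq_zero fun U _ => ?_
    rw [if_neg, mul_zero]
    rintro ⟨_, rfl⟩
    exact Finset.notMem_erase _ _ h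
  · rw [if_neg h, Finset.sum_eq_single (insert r T)]
    · rw [if_pos ⟨Finset.mem_insert_self _ _, (Finset.erase_insert h).symm⟩, jwSign_insert h]
      simp
    · intro U _ hU
      rw [if_neg, mul_zero]
      rintro ⟨h1, rfl⟩
      exact hU (Finset.insert_erase h1).symm
    · simp

theorem annihilation_anticomm (r s : Site d L) :
    annihilation r * annihilation s = -(annihilation s * annihilation r) := by
  ext S T
  rw [Matrix.neg_apply, mul_annihilation_apply, mul_annihilation_apply]
  simp only [annihilation_apply]
  by_cases hrs : r = s
  · subst hrs; simp
  have hsr : s ≠ r := fun h => hrs h.symm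
  by_cases hr : r ∈ T <;> by_cases hs : s ∈ T <;> simp only [Finset.mem_erase, hr, hs, hrs, hsr,
    ne_eq, not_false_iff, true_and, and_true, if_true, if_false, false_and, and_false, neg_zero,
    zero_mul]
  rw [Finset.erase_right_comm (a := s) (b := r)]
  split_ifs with h
  · rw [jwSign_erase hs, jwSign_erase hr]
    -- Distinct sites are strictly ordered, so exactly one of the two erasures flips the sign of the
    -- other.
    rcases lt_or_gt_of_ne (siteNumber_injective.ne hrs) with h1 | h1
    · rw [if_neg h1.not_gt, if_pos h1]; ring
    · rw [if_neg h1.not_gt, if_pos h1]; ring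
  · simp

theorem creation_anticomm (r s : Site d L) :
    creation r * creation s = -(creation s * creation r) := by
  simp only [creation, ← Matrix.conjTranspose_mul]
  rw [annihilation_anticomm, Matrix.conjTranspose_neg]

theorem annihilation_mul_creation (r s : Site d L) :
    annihilation r * creation s = (if r = s then 1 else 0) - creation s * annihilation r := by
  ext S T
  rw [Matrix.sub_apply, mul_creation_apply, mul_annihilation_apply, annihilation_apply,
    creation_apply]
  by_cases hrs : r = s
  · subst hrs
    -- For equal sites, one of the two products vanishes on the column `T` and the other is the
    -- identity there, because the sign squares to one.
    by_cases hr : r ∈ T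
    · simp only [hr, if_true, Matrix.one_apply]
      by_cases hST : S = T
      · subst hST
        simp [hr, jwSign_mul_self]
      · rw [if_neg hST, if_neg]
        · simp
        · rintro ⟨h1, h2⟩
          apply hST
          rw [← Finset.insert_erase h1, ← h2, Finset.insert_erase hr]
    · simp only [hr, if_false, if_true, Matrix.one_apply, Finset.mem_insert_self, true_and,
        Finset.erase_insert hr, jwSign_insert hr, lt_irrefl]
      by_cases hST : S = T <;> simp [hST, jwSign_mul_self]
  · have hsr : s ≠ r := fun h => hrs h.symm
    simp only [hrs, if_false, Matrix.zero_apply, Finset.mem_insert, false_or, zero_sub]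
    by_cases hr : r ∈ T <;> by_cases hs : s ∈ T <;> simp only [hr, hs, if_true, if_false, true_and,
      false_and, neg_zero, zero_mul]
    · rw [if_neg, zero_mul, neg_zero]
      rintro ⟨h1, h2⟩
      have : s ∈ T.erase r := Finset.mem_erase.2 ⟨hsr, hs⟩
      rw [h2] at this
      exact Finset.notMem_erase _ _ this
    · have key : S = (insert s T).erase r ↔ s ∈ S ∧ T.erase r = S.erase s := by
        rw [Finset.erase_insert_of_ne hsr]
        have hs' : s ∉ T.erase r := fun h => hs (Finset.mem_of_mem_erase h)
        constructor
        · rintro rfl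
          exact ⟨Finset.mem_insert_self _ _, (Finset.erase_insert hs').symm⟩
        · rintro ⟨h1, h2⟩
          rw [h2, Finset.insert_erase h1]
      by_cases hS : S = (insert s T).erase r
      · rw [if_pos hS, if_pos (key.1 hS)]
        have hs' : s ∉ T.erase r := fun h => hs (Finset.mem_of_mem_erase h)
        rw [hS, Finset.erase_insert_of_ne hsr, jwSign_insert hs, jwSign_insert hs',
          jwSign_erase hr]
        rcases lt_or_gt_of_ne (siteNumber_injective.ne hrs) with h1 | h1
        · rw [if_neg h1.not_gt, if_pos h1]; simp; ring
        · rw [if_neg h1.not_gt, if_pos h1]; simp; ring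
      · rw [if_neg hS, if_neg (fun h => hS (key.2 h))]; simp

/-! ### Commutators with the Hamiltonian and its quadratic form. -/

lemma hopping1D_symm (a b : Fin L) : hopping1D L a b = hopping1D L b a := by
  simp only [hopping1D, Matrix.of_apply, or_comm]

lemma hopping_symm (r s : Site d L) : hopping d L r s = hopping d L s r := by
  simp only [hopping, Matrix.of_apply]
  refine Finset.sum_congr rfl fun i _ => ?_
  rw [hopping1D_symm]
  congr 1
  refine Finset.prod_congr rfl fun l _ => ?_
  simp only [Matrix.one_apply, eq_comm]

lemma hopping_self (hL : 2 ≤ L) (r : Site d L) : hopping d L r r = 0 := by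
  simp only [hopping, Matrix.of_apply]
  refine Finset.sum_eq_zero fun i _ => ?_
  have : hopping1D L (r i) (r i) = 0 := by
    simp only [hopping1D, Matrix.of_apply, or_self]
    rw [if_neg]
    intro h
    have h2 := (r i).2
    rcases Nat.lt_or_ge ((r i : ℕ) + 1) L with h3 | h3
    · rw [Nat.mod_eq_of_lt h3] at h; omega
    · have : (r i : ℕ) + 1 = L := by omega
      rw [this, Nat.mod_self] at h; omega
  rw [this, zero_mul]

lemma commutator_annihilation (r : Site d L) :
    hamiltonian d L * annihilation r - annihilation r * hamiltonian d L =
      ∑ s, (-(hopping d L r s : ℂ)) • annihilation s := by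
  have h : ∀ a b : Site d L, creation a * annihilation b * annihilation r -
      annihilation r * (creation a * annihilation b) =
      if a = r then -annihilation b else 0 := by
    intro a b
    rw [mul_assoc, annihilation_anticomm b r, ← mul_assoc, annihilation_mul_creation]
    by_cases h : a = r
    · subst h; simp; noncomm_ring
    · rw [if_neg h, if_neg (fun h' => h h'.symm)]; noncomm_ring
  simp only [hamiltonian, Finset.sum_mul, Finset.mul_sum, ← Finset.sum_sub_distrib,
    smul_mul_assoc, mul_smul_comm, ← smul_sub, h]
  rw [Finset.sum_comm]
  simp

lemma commutator_creation (r : Site d L) :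
    hamiltonian d L * creation r - creation r * hamiltonian d L =
      ∑ s, (hopping d L r s : ℂ) • creation s := by
  have h : ∀ a b : Site d L, creation a * annihilation b * creation r -
      creation r * (creation a * annihilation b) =
      if b = r then creation a else 0 := by
    intro a b
    rw [mul_assoc, annihilation_mul_creation, ← mul_assoc (creation r), creation_anticomm r a]
    by_cases h : b = r
    · subst h; simp; noncomm_ring
    · rw [if_neg h, if_neg h]; noncomm_ring
  simp only [hamiltonian, Finset.sum_mul, Finset.mul_sum, ← Finset.sum_sub_distrib,
    smul_mul_assoc, mul_smul_comm, ← smul_sub, h]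
  simp [hopping_symm r]

lemma coupling_zero_zero (r s : Site d L) :
    coupling d L (r, 0) (s, 0) = (1 / 2) * (hopping d L r s : ℂ) := by
  simp [coupling, Matrix.blockDiagonal_apply]

lemma coupling_one_one (r s : Site d L) :
    coupling d L (r, 1) (s, 1) = -((1 / 2) * (hopping d L r s : ℂ)) := by
  simp [coupling, Matrix.blockDiagonal_apply]

lemma coupling_zero_one (r s : Site d L) : coupling d L (r, 0) (s, 1) = 0 := by
  simp [coupling, Matrix.blockDiagonal_apply]

lemma coupling_one_zero (r s : Site d L) : coupling d L (r, 1) (s, 0) = 0 := by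
  simp [coupling, Matrix.blockDiagonal_apply]

theorem commutator_modeOp (j : ModeIndex d L) :
    hamiltonian d L * modeOp j - modeOp j * hamiltonian d L =
      ∑ k, (-(2 * coupling d L j k)) • modeOp k := by
  obtain ⟨r, i⟩ := j
  rw [Fintype.sum_prod_type]
  simp only [Fin.sum_univ_two]
  fin_cases i
  · simp only [Fin.zero_eta, modeOp, if_true, coupling_zero_zero, coupling_zero_one]
    rw [commutator_annihilation]
    refine Finset.sum_congr rfl fun s _ => ?_
    simp
  · simp only [Fin.mk_one, modeOp, one_ne_zero, if_false, if_true, coupling_one_one,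
      coupling_one_zero]
    rw [commutator_creation]
    refine Finset.sum_congr rfl fun s _ => ?_
    simp

theorem hamiltonian_eq_sum_coupling (hL : 2 ≤ L) :
    hamiltonian d L = ∑ j : ModeIndex d L, ∑ k : ModeIndex d L,
      coupling d L j k • ((modeOp j).conjTranspose * modeOp k) := by
  simp only [Fintype.sum_prod_type, Fin.sum_univ_two, modeOp, one_ne_zero, if_false, if_true,
    coupling_zero_zero, coupling_zero_one, coupling_one_zero, coupling_one_one, zero_smul,
    add_zero, zero_add]
  have h1 : ∀ r : Site d L, (annihilation r)ᴴ = creation r := fun r => rfl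
  have h2 : ∀ r : Site d L, (creation r)ᴴ = annihilation r := fun r =>
    Matrix.conjTranspose_conjTranspose _
  -- Normal ordering produces a constant only for `r = s`, where the diagonal of the hopping matrix
  -- vanishes. The hole block thus repeats the particle block, and the two halves add up.
  have h3 : ∀ r s : Site d L, (-((1 / 2) * (hopping d L r s : ℂ))) •
      (annihilation r * creation s) =
      ((1 / 2) * (hopping d L s r : ℂ)) • (creation s * annihilation r) := by
    intro r s
    rw [annihilation_mul_creation, hopping_symm s r]
    by_cases h : r = s
    · subst h; simp [hopping_self hL]
    · simp [h]
  simp only [h1, h2, h3, Finset.sum_add_distrib]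
  rw [Finset.sum_comm (f := fun r s => ((1 / 2) * (hopping d L s r : ℂ)) •
      (creation s * annihilation r)), ← Finset.sum_add_distrib]
  simp only [← Finset.sum_add_distrib, ← add_smul, hamiltonian]
  refine Finset.sum_congr rfl fun r _ => Finset.sum_congr rfl fun s _ => ?_
  congr 1
  ring

/-! ### Heisenberg evolution of a family with linear commutators. -/

section Heisenberg

attribute [local instance] Matrix.linftyOpNormedRing Matrix.linftyOpNormedAlgebra

/-- If the commutators of `X` with a family `c` are linear in the family with coefficient matrix
`G`, then conjugation by `exp X` acts on the family through the matrix `exp G`. -/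
theorem exp_mul_mul_exp_neg_eq_sum {𝔸 ι : Type*} [NormedRing 𝔸] [NormedAlgebra ℂ 𝔸]
    [CompleteSpace 𝔸] [Fintype ι] [DecidableEq ι] (X : 𝔸) (G : Matrix ι ι ℂ) (c : ι → 𝔸)
    (h : ∀ j, X * c j - c j * X = ∑ k, G j k • c k) (j : ι) :
    NormedSpace.exp X * c j * NormedSpace.exp (-X) = ∑ k, NormedSpace.exp G j k • c k := by
  -- Evolving the coefficients forward and the operators backward cancels: the derivative of `Z` is
  -- zero. Comparing `Z 1` with `Z 0 = c j` and conjugating by `exp X` gives the claim.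
  let Z : ℂ → 𝔸 := fun z => ∑ k, NormedSpace.exp (z • G) j k •
    (NormedSpace.exp (z • (-X)) * c k * NormedSpace.exp (z • X))
  have hZ : ∀ z, HasDerivAt Z 0 z := by
    intro z
    have hG : ∀ k, HasDerivAt (fun u : ℂ => NormedSpace.exp (u • G) j k)
        ((NormedSpace.exp (z • G) * G) j k) z := fun k =>
      (LinearMap.toContinuousLinearMap (Matrix.entryLinearMap ℂ ℂ j k)).hasFDerivAt.comp_hasDerivAt
        z (hasDerivAt_exp_smul_const G z)
    have hX : ∀ k, HasDerivAt
        (fun u : ℂ => NormedSpace.exp (u • (-X)) * c k * NormedSpace.exp (u • X))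
        (-(NormedSpace.exp (z • (-X)) * (∑ l, G k l • c l) * NormedSpace.exp (z • X))) z := by
      intro k
      have := ((hasDerivAt_exp_smul_const (-X) z).mul_const (c k)).mul
        (hasDerivAt_exp_smul_const' X z)
      refine this.congr_deriv ?_
      rw [← h k]
      noncomm_ring
    have hsum := HasDerivAt.fun_sum (u := Finset.univ) fun k _ => (hG k).smul (hX k)
    refine hsum.congr_deriv ?_
    rw [Finset.sum_add_distrib]
    simp only [smul_neg, Finset.sum_neg_distrib, Matrix.mul_apply, Finset.sum_smul,
      Finset.mul_sum, Finset.sum_mul, mul_smul_comm, smul_mul_assoc, Finset.smul_sum, smul_smul]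
    rw [Finset.sum_comm, neg_add_cancel]
  have hconst : Z 1 = Z 0 := is_const_of_deriv_eq_zero (fun z => (hZ z).differentiableAt)
    (fun z => (hZ z).deriv) 1 0
  simp only [Z, one_smul, zero_smul, NormedSpace.exp_zero, one_mul, mul_one, Matrix.one_apply,
    ite_smul, Finset.sum_ite_eq, Finset.mem_univ, if_true] at hconst
  have h1 : NormedSpace.exp X * NormedSpace.exp (-X) = 1 := by
    let : NormedAlgebra ℚ 𝔸 := NormedAlgebra.restrictScalars ℚ ℂ 𝔸
    rw [← NormedSpace.exp_add_of_commute (Commute.neg_right (Commute.refl X)), add_neg_cancel,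
      NormedSpace.exp_zero]
  rw [← hconst, Finset.mul_sum, Finset.sum_mul]
  refine Finset.sum_congr rfl fun k _ => ?_
  rw [mul_smul_comm, smul_mul_assoc]
  congr 1
  calc _ = (NormedSpace.exp X * NormedSpace.exp (-X)) * c k *
        (NormedSpace.exp X * NormedSpace.exp (-X)) := by simp only [mul_assoc]
    _ = c k := by rw [h1, one_mul, mul_one]

theorem heisenberg_modeOp {d L : ℕ} (t : ℝ) (j : ModeIndex d L) :
    heisenberg t (modeOp j) = ∑ k : ModeIndex d L, propagator d L t j k • modeOp k := by
  unfold heisenberg propagator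
  rw [neg_smul]
  refine exp_mul_mul_exp_neg_eq_sum _ _ _ (fun j => ?_) j
  rw [smul_mul_assoc, mul_smul_comm, ← smul_sub, commutator_modeOp, Finset.smul_sum]
  refine Finset.sum_congr rfl fun k _ => ?_
  rw [smul_smul, Matrix.smul_apply, smul_eq_mul]
  congr 1
  ring

lemma exp_pi_apply {ι 𝔸 : Type*} [Fintype ι] [NormedRing 𝔸] [NormedAlgebra ℂ 𝔸] [CompleteSpace 𝔸]
    (v : ι → 𝔸) (i : ι) : NormedSpace.exp v i = NormedSpace.exp (v i) := by
  let : NormedAlgebra ℚ 𝔸 := NormedAlgebra.restrictScalars ℚ ℂ 𝔸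
  exact Pi.coe_exp v i

lemma exp_pi_matrix_apply {ι n : Type*} [Fintype ι] [Fintype n] [DecidableEq n]
    (v : ι → Matrix n n ℂ) (i : ι) : NormedSpace.exp v i = NormedSpace.exp (v i) :=
  exp_pi_apply v i

end Heisenberg

/-! ### Unitarity and block structure of the propagator. -/

lemma coupling_conjTranspose (d L : ℕ) : (coupling d L)ᴴ = coupling d L := by
  ext ⟨r, i⟩ ⟨s, j⟩
  rw [Matrix.conjTranspose_apply]
  fin_cases i <;> fin_cases j <;>
    simp [coupling_zero_zero, coupling_zero_one, coupling_one_zero, coupling_one_one,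
      hopping_symm s r]

theorem norm_propagator_le_one {d L : ℕ} (t : ℝ) (j k : ModeIndex d L) :
    ‖propagator d L t j k‖ ≤ 1 := by
  refine entry_norm_bound_of_unitary (U := propagator d L t) ?_ j k
  have hconj : ((-(2 * Complex.I * (t : ℂ))) • coupling d L)ᴴ =
      -((-(2 * Complex.I * (t : ℂ))) • coupling d L) := by
    rw [Matrix.conjTranspose_smul, coupling_conjTranspose, ← neg_smul]
    congr 1
    simp
  rw [Matrix.mem_unitaryGroup_iff, Matrix.star_eq_conjTranspose, propagator,
    ← Matrix.exp_conjTranspose, hconj,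
    ← Matrix.exp_add_of_commute _ _
      (Commute.refl (_ : Matrix (ModeIndex d L) (ModeIndex d L) ℂ)).neg_right, add_neg_cancel,
    NormedSpace.exp_zero]

lemma propagator_apply {d L : ℕ} (t : ℝ) (j k : ModeIndex d L) :
    propagator d L t j k = if j.2 = k.2 then
      NormedSpace.exp (((if j.2 = 0 then -(Complex.I * t) else Complex.I * t) : ℂ) •
        (hopping d L).map Complex.ofReal) j.1 k.1 else 0 := by
  have h := Matrix.exp_blockDiagonal ((-(2 * Complex.I * (t : ℂ))) •
    ![(1 / 2 : ℂ) • (hopping d L).map Complex.ofReal,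
      -((1 / 2 : ℂ) • (hopping d L).map Complex.ofReal)])
  rw [Matrix.blockDiagonal_smul] at h
  rw [propagator, coupling, h, Matrix.blockDiagonal_apply, exp_pi_matrix_apply]
  obtain ⟨r, i⟩ := j
  congr 3
  fin_cases i
  · simp [smul_smul]; ring_nf
  · simp [smul_smul]; ring_nf

end FermionHopping
end

noncomputable section

/-! ### The exponential sum: truncated cotangent, variation, and counting of exceptional indices. -/

section ExponentialSum

open Real Set

/-- This follows from `cot x - cot y = sin (y - x) / (sin x sin y)`. -/
lemma cos_div_sin_le {x y : ℝ} (hxy : x ≤ y) (hπ : y - x ≤ π) (h : 0 < sin x * sin y) :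
    cos y / sin y ≤ cos x / sin x := by
  have hx : sin x ≠ 0 := left_ne_zero_of_mul h.ne'
  have hy : sin y ≠ 0 := right_ne_zero_of_mul h.ne'
  have h1 : cos x / sin x - cos y / sin y = sin (y - x) / (sin x * sin y) := by
    rw [sin_sub]; field_simp
  have h2 : 0 ≤ sin (y - x) / (sin x * sin y) :=
    div_nonneg (sin_nonneg_of_nonneg_of_le_pi (by linarith) hπ) h.le
  linarith

/-- The cotangent, replaced by a linear function on `(-a, a)`. -/
def truncCot (a x : ℝ) : ℝ := if |x| < a then x / a * (cos a / sin a) else cos x / sin x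

lemma truncCot_of_abs_le {a x : ℝ} (ha : 0 < a) (h : |x| ≤ a) :
    truncCot a x = x / a * (cos a / sin a) := by
  unfold truncCot
  split_ifs with h1
  · rfl
  · have : |x| = a := le_antisymm h (not_lt.1 h1)
    rcases eq_or_eq_neg_of_abs_eq this with rfl | rfl
    · rw [div_self ha.ne', one_mul]
    · rw [neg_div, div_self ha.ne', cos_neg, sin_neg, div_neg]; ring

lemma truncCot_of_le_abs {a x : ℝ} (h : a ≤ |x|) : truncCot a x = cos x / sin x :=
  if_neg h.not_gt

lemma truncCot_neg (a x : ℝ) : truncCot a (-x) = -truncCot a x := by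
  unfold truncCot
  rw [abs_neg, cos_neg, sin_neg]
  split_ifs <;> ring

lemma cos_div_sin_nonneg {a : ℝ} (ha : 0 < a) (ha1 : a ≤ 1) : 0 ≤ cos a / sin a := by
  have hπ := pi_gt_three
  exact div_nonneg (cos_nonneg_of_mem_Icc ⟨by linarith, by linarith⟩)
    (sin_pos_of_pos_of_lt_pi ha (by linarith)).le

lemma cos_div_sin_le_inv {a : ℝ} (ha : 0 < a) (ha1 : a ≤ 1) : cos a / sin a ≤ 1 / a := by
  have hπ := pi_gt_three
  have hs := sin_pos_of_pos_of_lt_pi ha (by linarith)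
  have hc : 0 < cos a := cos_pos_of_mem_Ioo ⟨by linarith, by linarith⟩
  have h := lt_tan ha (by linarith)
  rw [tan_eq_sin_div_cos, lt_div_iff₀ hc] at h
  rw [div_le_div_iff₀ hs ha]
  linarith

lemma truncCot_antitoneOn {a : ℝ} (ha : 0 < a) :
    AntitoneOn (truncCot a) (Icc a (3 * π / 4)) := by
  intro x hx y hy hxy
  have hπ := pi_pos
  have hs : ∀ z ∈ Icc a (3 * π / 4), 0 < sin z := fun z hz =>
    sin_pos_of_pos_of_lt_pi (ha.trans_le hz.1) (by linarith [hz.2])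
  rw [truncCot_of_le_abs (hx.1.trans (le_abs_self x)),
    truncCot_of_le_abs (hy.1.trans (le_abs_self y))]
  exact cos_div_sin_le hxy (by linarith [hx.1, hy.2]) (mul_pos (hs x hx) (hs y hy))

lemma truncCot_antitoneOn_neg {a : ℝ} (ha : 0 < a) :
    AntitoneOn (truncCot a) (Icc (-(3 * π / 4)) (-a)) := by
  intro x hx y hy hxy
  have := @truncCot_antitoneOn a ha (-y) ⟨by linarith [hy.2], by linarith [hy.1]⟩ (-x)
    ⟨by linarith [hx.2], by linarith [hx.1]⟩ (by linarith)
  rw [truncCot_neg, truncCot_neg] at this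
  linarith

lemma truncCot_monotoneOn {a : ℝ} (ha : 0 < a) (ha1 : a ≤ 1) :
    MonotoneOn (truncCot a) (Icc (-a) a) := by
  intro x hx y hy hxy
  rw [truncCot_of_abs_le ha (abs_le.2 hx), truncCot_of_abs_le ha (abs_le.2 hy)]
  have := cos_div_sin_nonneg ha ha1
  gcongr

lemma truncCot_three_pi_div_four {a : ℝ} (ha1 : a ≤ 1) : truncCot a (3 * π / 4) = -1 := by
  have hπ := pi_gt_three
  rw [truncCot_of_le_abs (by rw [abs_of_pos (by linarith)]; linarith),
    show 3 * π / 4 = π - π / 4 by ring, cos_pi_sub, sin_pi_sub, cos_pi_div_four, sin_pi_div_four,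
    neg_div, div_self (by positivity)]

lemma truncCot_self (a : ℝ) : truncCot a a = cos a / sin a :=
  truncCot_of_le_abs (le_abs_self a)

lemma abs_truncCot_le {a x : ℝ} (ha : 0 < a) (ha1 : a ≤ 1) (hx : |x| ≤ 3 * π / 4) :
    |truncCot a x| ≤ 1 / a := by
  have h0 := cos_div_sin_nonneg ha ha1
  have h1 := cos_div_sin_le_inv ha ha1
  have h2 : 1 ≤ 1 / a := (le_div_iff₀ ha).2 (by linarith)
  have h3 : ∀ x, a ≤ x → x ≤ 3 * π / 4 → |truncCot a x| ≤ 1 / a := by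
    intro x hx hx'
    have hπ := pi_gt_three
    have hu := truncCot_antitoneOn ha ⟨le_refl a, by linarith⟩ ⟨hx, hx'⟩ hx
    have hl := truncCot_antitoneOn ha ⟨hx, hx'⟩ ⟨by linarith, le_refl (3 * π / 4)⟩ hx'
    rw [truncCot_three_pi_div_four ha1] at hl
    rw [truncCot_self] at hu
    exact abs_le.2 ⟨by linarith, by linarith⟩
  rcases lt_or_ge |x| a with h | h
  · rw [truncCot_of_abs_le ha h.le, abs_mul, abs_div, abs_of_pos ha, abs_of_nonneg h0]
    calc |x| / a * (cos a / sin a) ≤ 1 * (1 / a) := by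
          gcongr
          exact (div_le_one ha).2 h.le
      _ = 1 / a := one_mul _
  · rcases le_total 0 x with hx0 | hx0
    · rw [abs_of_nonneg hx0] at h hx
      exact h3 x h hx
    · rw [abs_of_nonpos hx0] at h hx
      have := h3 (-x) h hx
      rwa [truncCot_neg, abs_neg] at this

lemma eVariationOn_Icc_le_of_antitoneOn {f : ℝ → ℝ} {a b : ℝ} (hab : a ≤ b)
    (hf : AntitoneOn f (Icc a b)) : eVariationOn f (Icc a b) ≤ ENNReal.ofReal (f a - f b) := by
  have ha := left_mem_Icc.2 hab
  have hb := right_mem_Icc.2 hab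
  have hmaps : MapsTo f (Icc a b) (Icc (f b) (f a)) := fun x hx =>
    ⟨hf hx hb hx.2, hf ha hx hx.1⟩
  have h1 := eVariationOn.comp_le_of_antitoneOn (id : ℝ → ℝ) f hf hmaps
  have h2 := (monotone_id.monotoneOn (Icc (f b) (f a))).eVariationOn_eq
    (left_mem_Icc.2 (hf ha hb hab)) (right_mem_Icc.2 (hf ha hb hab))
  rw [inter_self] at h2
  exact h1.trans h2.le

/-- The function falls from `1` to `-cot a`, rises to `cot a` and falls to `-1`. Each of the three
pieces varies by at most `2 / a`, since `cot a` and `1` are at most `1 / a`. -/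
lemma eVariationOn_truncCot_le {a : ℝ} (ha : 0 < a) (ha1 : a ≤ 1) :
    eVariationOn (truncCot a) (Icc (-(3 * π / 4)) (3 * π / 4)) ≤ ENNReal.ofReal (6 / a) := by
  have hπ := pi_gt_three
  have h1 := cos_div_sin_le_inv ha ha1
  have h2 : 1 ≤ 1 / a := (le_div_iff₀ ha).2 (by linarith)
  have e1 := eVariationOn.Icc_add_Icc (truncCot a) (s := univ) (a := -(3 * π / 4)) (b := -a)
    (c := a) (by linarith) (by linarith) (mem_univ _)
  have e2 := eVariationOn.Icc_add_Icc (truncCot a) (s := univ) (a := -(3 * π / 4)) (b := a)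
    (c := 3 * π / 4) (by linarith) (by linarith) (mem_univ _)
  simp only [univ_inter] at e1 e2
  rw [← e2, ← e1]
  have b1 := eVariationOn_Icc_le_of_antitoneOn (by linarith) (truncCot_antitoneOn_neg ha)
  have b2 := ((truncCot_monotoneOn ha ha1).eVariationOn_eq (left_mem_Icc.2 (by linarith))
    (right_mem_Icc.2 (by linarith))).le
  have b3 := eVariationOn_Icc_le_of_antitoneOn (by linarith) (truncCot_antitoneOn ha)
  rw [inter_self] at b2
  simp only [truncCot_neg, truncCot_three_pi_div_four ha1, truncCot_self] at b1 b2 b3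
  have h6 : 6 / a = 2 / a + 2 / a + 2 / a := by ring
  have h2a : 2 / a = 1 / a + 1 / a := by ring
  rw [h6, ENNReal.ofReal_add (by positivity) (by positivity),
    ENNReal.ofReal_add (by positivity) (by positivity)]
  refine add_le_add (add_le_add (b1.trans ?_) (b2.trans ?_)) (b3.trans ?_) <;>
    exact ENNReal.ofReal_le_ofReal (by linarith)

lemma sin_monotoneOn_Icc_three_halves : MonotoneOn sin (Icc (3 * π / 2) (2 * π)) := by
  intro x hx y hy hxy
  have := monotoneOn_sin (a := x - 2 * π) (b := y - 2 * π)
    ⟨by linarith [hx.1], by linarith [hx.2, pi_pos]⟩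
    ⟨by linarith [hy.1], by linarith [hy.2, pi_pos]⟩ (by linarith)
  rwa [sin_sub_two_pi, sin_sub_two_pi] at this

lemma sin_antitoneOn_Icc : AntitoneOn sin (Icc (π / 2) (3 * π / 2)) := by
  intro x hx y hy hxy
  have := monotoneOn_sin (a := π - y) (b := π - x) ⟨by linarith [hy.2], by linarith [hy.1]⟩
    ⟨by linarith [hx.2], by linarith [hx.1]⟩ (by linarith)
  rwa [sin_pi_sub, sin_pi_sub] at this

/-- The variation of `f (α - β sin θ)` over a period is at most three times that of `f`. -/
lemma eVariationOn_comp_sub_mul_sin_le (f : ℝ → ℝ) {α β R : ℝ} (hβ : 0 ≤ β) (hR : |α| + β ≤ R) :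
    eVariationOn (fun θ => f (α - β * sin θ)) (Icc 0 (2 * π)) ≤
      3 * eVariationOn f (Icc (-R) R) := by
  have hπ := pi_pos
  have hmaps : ∀ s, MapsTo (fun θ => α - β * sin θ) s (Icc (-R) R) := by
    intro s θ _
    have h1 := abs_le.1 (le_refl |α|)
    have h2 := mul_le_mul_of_nonneg_left (sin_le_one θ) hβ
    have h3 := mul_le_mul_of_nonneg_left (neg_one_le_sin θ) hβ
    exact ⟨by dsimp only; linarith, by dsimp only; linarith⟩
  have e1 := eVariationOn.Icc_add_Icc (fun θ => f (α - β * sin θ)) (s := univ) (a := 0)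
    (b := π / 2) (c := 3 * π / 2) (by linarith) (by linarith) (mem_univ _)
  have e2 := eVariationOn.Icc_add_Icc (fun θ => f (α - β * sin θ)) (s := univ) (a := 0)
    (b := 3 * π / 2) (c := 2 * π) (by linarith) (by linarith) (mem_univ _)
  simp only [univ_inter] at e1 e2
  rw [← e2, ← e1, show (3 : ENNReal) = 1 + 1 + 1 by norm_num, add_mul, add_mul, one_mul]
  refine add_le_add (add_le_add ?_ ?_) ?_
  · refine eVariationOn.comp_le_of_antitoneOn f (fun θ => α - β * sin θ) ?_ (hmaps _)
    intro x hx y hy hxy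
    have := monotoneOn_sin ⟨by linarith [hx.1], hx.2⟩ ⟨by linarith [hy.1], hy.2⟩ hxy
    have := mul_le_mul_of_nonneg_left this hβ
    dsimp only; linarith
  · refine eVariationOn.comp_le_of_monotoneOn f (fun θ => α - β * sin θ) ?_ (hmaps _)
    intro x hx y hy hxy
    have := mul_le_mul_of_nonneg_left (sin_antitoneOn_Icc hx hy hxy) hβ
    dsimp only; linarith
  · refine eVariationOn.comp_le_of_antitoneOn f (fun θ => α - β * sin θ) ?_ (hmaps _)
    intro x hx y hy hxy
    have := mul_le_mul_of_nonneg_left (sin_monotoneOn_Icc_three_halves hx hy hxy) hβ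
    dsimp only; linarith

/-- Summation by parts. -/
lemma sum_sub_mul_eq {R : Type*} [CommRing R] (e g : ℕ → R) (n : ℕ) :
    ∑ k ∈ Finset.range (n + 1), (e (k + 1) - e k) * g k =
      e (n + 1) * g n - e 0 * g 0 - ∑ k ∈ Finset.range n, e (k + 1) * (g (k + 1) - g k) := by
  induction n with
  | zero => simp; ring
  | succ n ih => rw [Finset.sum_range_succ, ih, Finset.sum_range_succ _ n]; ring

/-- Off the truncation window the factor is the exact inverse of `exp (2 i x) - 1`, so the defect is
zero. Inside, `|exp (2 i x) - 1| ≤ 2 a` compensates the size `1 / a` of the factor, and the defect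
is at most `1 + (a + 1) ≤ 3`. -/
lemma norm_one_sub_mul_truncCot_le {a x : ℝ} (ha : 0 < a) (ha1 : a ≤ 1) (hx : |x| ≤ 3 * π / 4) :
    ‖1 - (Complex.exp (((2 * x : ℝ) : ℂ) * Complex.I) - 1) *
      (-(1 + Complex.I * (truncCot a x : ℂ)) / 2)‖ ≤ if |x| < a then 3 else 0 := by
  have hexp : Complex.exp (((2 * x : ℝ) : ℂ) * Complex.I) =
      ((cos x : ℂ) + (sin x : ℂ) * Complex.I) ^ 2 := by
    rw [Complex.ofReal_cos, Complex.ofReal_sin, ← Complex.exp_mul_I, ← Complex.exp_nat_mul]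
    push_cast; ring_nf
  have hcs : (cos x : ℂ) ^ 2 + (sin x : ℂ) ^ 2 = 1 := by exact_mod_cast cos_sq_add_sin_sq x
  have hI := Complex.I_sq
  split_ifs with h
  · have h1 : Complex.exp (((2 * x : ℝ) : ℂ) * Complex.I) - 1 = 2 * (sin x : ℂ) *
        (Complex.I * Complex.exp ((x : ℂ) * Complex.I)) := by
      rw [hexp, Complex.exp_mul_I, ← Complex.ofReal_cos, ← Complex.ofReal_sin]
      linear_combination hcs - (sin x : ℂ) ^ 2 * hI
    have h2 : ‖Complex.exp (((2 * x : ℝ) : ℂ) * Complex.I) - 1‖ ≤ 2 * a := by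
      rw [h1, norm_mul, norm_mul, norm_mul, Complex.norm_I, Complex.norm_exp_ofReal_mul_I,
        Complex.norm_real, Complex.norm_ofNat, Real.norm_eq_abs, one_mul, mul_one]
      have := abs_sin_le_abs (x := x)
      linarith
    have h3 : ‖-(1 + Complex.I * (truncCot a x : ℂ)) / 2‖ ≤ (1 + 1 / a) / 2 := by
      rw [norm_div, norm_neg, Complex.norm_ofNat]
      gcongr
      refine (norm_add_le _ _).trans ?_
      rw [norm_one, norm_mul, Complex.norm_I, one_mul, Complex.norm_real, Real.norm_eq_abs]
      gcongr
      exact abs_truncCot_le ha ha1 hx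
    refine (norm_sub_le _ _).trans ?_
    rw [norm_one, norm_mul]
    have := mul_le_mul h2 h3 (norm_nonneg _) (by positivity)
    have h4 : 2 * a * ((1 + 1 / a) / 2) = a + 1 := by field_simp
    linarith
  · have hs : (sin x : ℂ) ≠ 0 := by
      intro h0
      have h0' : sin x = 0 := by exact_mod_cast h0
      have hπ := pi_pos
      have hb := abs_le.1 hx
      have := (sin_eq_zero_iff_of_lt_of_lt (by linarith) (by linarith)).1 h0'
      rw [this, abs_zero] at h
      exact h ha
    rw [truncCot_of_le_abs (not_lt.1 h), hexp, norm_le_zero_iff]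
    have ht : ((cos x / sin x : ℝ) : ℂ) * (sin x : ℂ) = (cos x : ℂ) := by
      rw [Complex.ofReal_div, div_mul_cancel₀ _ hs]
    generalize ((cos x / sin x : ℝ) : ℂ) = t at ht ⊢
    generalize (cos x : ℂ) = c at *
    generalize (sin x : ℂ) = s at *
    linear_combination Complex.I ^ 2 * (c + s * Complex.I) * ht +
      (s ^ 2 + c ^ 2 + Complex.I * s * c) * hI - hcs +
      (1 + Complex.I * t) / 2 * (hcs - s ^ 2 * hI)

/-- A discrete first derivative test with an exceptional set. -/
lemma norm_sum_exp_le (φ x : ℕ → ℝ) (hφ : ∀ k, φ (k + 1) - φ k = 2 * x k) {a B : ℝ}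
    (ha : 0 < a) (ha1 : a ≤ 1) (hx : ∀ k, |x k| ≤ 3 * π / 4) (n : ℕ)
    (hvar : ∑ k ∈ Finset.range n, |truncCot a (x (k + 1)) - truncCot a (x k)| ≤ B) :
    ‖∑ k ∈ Finset.range (n + 1), Complex.exp ((φ k : ℂ) * Complex.I)‖ ≤
      3 * ((Finset.range (n + 1)).filter fun k => |x k| < a).card + 2 / a + B / 2 := by
  set e : ℕ → ℂ := fun k => Complex.exp ((φ k : ℂ) * Complex.I) with he
  set g : ℕ → ℂ := fun k => -(1 + Complex.I * (truncCot a (x k) : ℂ)) / 2 with hg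
  have hen : ∀ k, ‖e k‖ = 1 := fun k => Complex.norm_exp_ofReal_mul_I _
  have hgn : ∀ k, ‖g k‖ ≤ 1 / a := by
    intro k
    have h2 : 1 ≤ 1 / a := (le_div_iff₀ ha).2 (by linarith)
    rw [hg]
    dsimp only
    rw [norm_div, norm_neg, Complex.norm_ofNat, div_le_iff₀ two_pos]
    refine (norm_add_le _ _).trans ?_
    rw [norm_one, norm_mul, Complex.norm_I, one_mul, Complex.norm_real, Real.norm_eq_abs]
    linarith [abs_truncCot_le ha ha1 (hx k)]
  have hgd : ∀ k, ‖g (k + 1) - g k‖ = |truncCot a (x (k + 1)) - truncCot a (x k)| / 2 := by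
    intro k
    have : g (k + 1) - g k =
        -Complex.I * ((truncCot a (x (k + 1)) - truncCot a (x k) : ℝ) : ℂ) / 2 := by
      rw [hg]; push_cast; ring
    rw [this, norm_div, norm_mul, norm_neg, Complex.norm_I, one_mul, Complex.norm_real,
      Complex.norm_ofNat, Real.norm_eq_abs]
  -- Each term is a telescoping difference with weight `g k`, plus the truncation defect.
  have hsplit : ∀ k, e k = (e (k + 1) - e k) * g k +
      e k * (1 - (Complex.exp (((2 * x k : ℝ) : ℂ) * Complex.I) - 1) * g k) := by
    intro k
    have : e (k + 1) = e k * Complex.exp (((2 * x k : ℝ) : ℂ) * Complex.I) := by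
      rw [he]
      dsimp only
      rw [← Complex.exp_add, ← hφ k]
      push_cast; ring_nf
    rw [this]; ring
  have hsum : ∑ k ∈ Finset.range (n + 1), e k =
      (e (n + 1) * g n - e 0 * g 0 - ∑ k ∈ Finset.range n, e (k + 1) * (g (k + 1) - g k)) +
      ∑ k ∈ Finset.range (n + 1),
        e k * (1 - (Complex.exp (((2 * x k : ℝ) : ℂ) * Complex.I) - 1) * g k) := by
    rw [← sum_sub_mul_eq, ← Finset.sum_add_distrib]
    exact Finset.sum_congr rfl fun k _ => hsplit k
  rw [hsum]
  have b1 : ‖∑ k ∈ Finset.range n, e (k + 1) * (g (k + 1) - g k)‖ ≤ B / 2 := by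
    refine (norm_sum_le _ _).trans ?_
    simp only [norm_mul, hen, one_mul, hgd, ← Finset.sum_div]
    gcongr
  have b2 : ‖∑ k ∈ Finset.range (n + 1),
      e k * (1 - (Complex.exp (((2 * x k : ℝ) : ℂ) * Complex.I) - 1) * g k)‖ ≤
      3 * ((Finset.range (n + 1)).filter fun k => |x k| < a).card := by
    refine (norm_sum_le _ _).trans ?_
    simp only [norm_mul, hen, one_mul]
    refine (Finset.sum_le_sum fun k _ => norm_one_sub_mul_truncCot_le ha ha1 (hx k)).trans ?_
    rw [← Finset.sum_filter, Finset.sum_const, nsmul_eq_mul, mul_comm]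
  have b3 : ‖e (n + 1) * g n - e 0 * g 0‖ ≤ 2 / a := by
    refine (norm_sub_le _ _).trans ?_
    rw [norm_mul, norm_mul, hen, hen, one_mul, one_mul, show 2 / a = 1 / a + 1 / a by ring]
    exact add_le_add (hgn n) (hgn 0)
  have t1 := norm_add_le (e (n + 1) * g n - e 0 * g 0 -
    ∑ k ∈ Finset.range n, e (k + 1) * (g (k + 1) - g k)) (∑ k ∈ Finset.range (n + 1),
      e k * (1 - (Complex.exp (((2 * x k : ℝ) : ℂ) * Complex.I) - 1) * g k))
  have t2 := norm_sub_le (e (n + 1) * g n - e 0 * g 0)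
    (∑ k ∈ Finset.range n, e (k + 1) * (g (k + 1) - g k))
  linarith

lemma card_le_of_sub_le (s : Finset ℕ) {D : ℝ} (hD : 0 ≤ D)
    (h : ∀ k ∈ s, ∀ l ∈ s, k ≤ l → (l : ℝ) - k ≤ D) : (s.card : ℝ) ≤ D + 1 := by
  rcases s.eq_empty_or_nonempty with rfl | hs
  · simp; linarith
  · have hsub : s ⊆ Finset.Icc (s.min' hs) (s.max' hs) := fun k hk =>
      Finset.mem_Icc.2 ⟨s.min'_le k hk, s.le_max' k hk⟩
    have hc := Finset.card_le_card hsub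
    have hm := s.min'_le_max' hs
    have hd := h _ (s.min'_mem hs) _ (s.max'_mem hs) hm
    rw [Nat.card_Icc] at hc
    have : s.card + s.min' hs ≤ s.max' hs + 1 := by omega
    have : (s.card : ℝ) + s.min' hs ≤ s.max' hs + 1 := by exact_mod_cast this
    linarith

/-- In `sin y - sin x = 2 sin ((y - x) / 2) cos ((y + x) / 2)` the cosine dominates the sine,
because `|y + x| / 2 ≤ π / 2 - (y - x) / 2`. This is the quadratic lower bound that survives up to
the turning points. -/
lemma two_mul_sin_sq_le_abs_sin_sub {x y : ℝ} (hx : -(π / 2) ≤ x) (hy : y ≤ π / 2) (hxy : x ≤ y) :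
    2 * sin ((y - x) / 2) ^ 2 ≤ sin y - sin x := by
  rw [sin_sub_sin]
  have hs : 0 ≤ sin ((y - x) / 2) :=
    sin_nonneg_of_nonneg_of_le_pi (by linarith) (by linarith [pi_pos])
  have hc : sin ((y - x) / 2) ≤ cos ((y + x) / 2) := by
    rw [← cos_pi_div_two_sub, ← cos_abs ((y + x) / 2)]
    refine cos_le_cos_of_nonneg_of_le_pi (abs_nonneg _) (by linarith [pi_pos]) ?_
    exact abs_le.2 ⟨by linarith, by linarith⟩
  nlinarith

/-- On an interval of length `π` centred at a zero of the sine, points with close values of the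
sine are close. -/
lemma sub_le_of_abs_sin_sub_le {c x y ε : ℝ} (hc : sin c = 0) (hx : c - π / 2 ≤ x)
    (hy : y ≤ c + π / 2) (hxy : x ≤ y) (h : |sin y - sin x| ≤ 2 * ε ^ 2) (hε : 0 ≤ ε) :
    y - x ≤ π * ε := by
  have hcc : |cos c| = 1 := by
    have := cos_sq_add_sin_sq c
    rw [hc] at this
    rw [← sqrt_sq_eq_abs]
    simp at this ⊢
    rcases this with h | h <;> simp [h]
  have hshift : ∀ z, sin z = sin (z - c) * cos c := by
    intro z
    have := sin_add (z - c) c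
    rw [hc, mul_zero, add_zero, sub_add_cancel] at this
    exact this
  rw [hshift y, hshift x, ← sub_mul, abs_mul, hcc, mul_one] at h
  have h1 := two_mul_sin_sq_le_abs_sin_sub (x := x - c) (y := y - c) (by linarith) (by linarith)
    (by linarith)
  rw [sub_sub_sub_cancel_right] at h1
  have h2 : sin ((y - x) / 2) ^ 2 ≤ ε ^ 2 := by linarith [le_abs_self (sin (y - c) - sin (x - c))]
  have h3 : sin ((y - x) / 2) ≤ ε := le_of_sq_le_sq h2 hε
  have h4 := mul_le_sin (x := (y - x) / 2) (by linarith) (by linarith)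
  have hπ := pi_pos
  have h5 : 2 / π * ((y - x) / 2) = (y - x) / π := by ring
  rw [h5] at h4
  have := (div_le_iff₀ hπ).1 (h4.trans h3)
  linarith

lemma card_abs_sub_mul_sin_lt_le (L : ℕ) (hL : 0 < L) {α β a ε : ℝ} (hβ : 0 < β) (hε : 0 ≤ ε)
    (ha : a ≤ β * ε ^ 2) :
    (((Finset.range L).filter fun k : ℕ =>
      |α - β * sin (2 * π * ((k : ℝ) + 1 / 2) / L)| < a).card : ℝ) ≤ 3 * (L * ε / 2 + 1) := by
  have hL' : (0 : ℝ) < L := by exact_mod_cast hL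
  have hπ := pi_pos
  set θ : ℕ → ℝ := fun k => 2 * π * ((k : ℝ) + 1 / 2) / L with hθ
  set s := (Finset.range L).filter fun k : ℕ => |α - β * sin (θ k)| < a with hs
  have hpiece : ∀ c : ℝ, sin c = 0 →
      ((s.filter fun k => c - π / 2 ≤ θ k ∧ θ k ≤ c + π / 2).card : ℝ) ≤ L * ε / 2 + 1 := by
    intro c hc
    refine card_le_of_sub_le _ (by positivity) fun k hk l hl hkl => ?_
    simp only [hs, Finset.mem_filter] at hk hl
    have hkl' : (k : ℝ) ≤ l := by exact_mod_cast hkl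
    have hle : θ k ≤ θ l := by simp only [hθ]; gcongr
    have hsin : |sin (θ l) - sin (θ k)| ≤ 2 * ε ^ 2 := by
      have h1 := abs_lt.1 hk.1.2
      have h2 := abs_lt.1 hl.1.2
      have h3 : β * |sin (θ l) - sin (θ k)| ≤ β * (2 * ε ^ 2) := by
        rw [← abs_of_pos hβ, ← abs_mul, abs_of_pos hβ, abs_le]
        constructor <;> nlinarith
      exact le_of_mul_le_mul_left h3 hβ
    have h4 := sub_le_of_abs_sin_sub_le hc hk.2.1 hl.2.2 hle hsin hε
    have h5 : θ l - θ k = 2 * π * ((l : ℝ) - k) / L := by simp only [hθ]; ring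
    rw [h5, div_le_iff₀ hL'] at h4
    nlinarith
  -- The sine is monotone on each of the three intervals of length `π` centred at `0`, `π` and `2π`,
  -- which together cover the period.
  have hcover : s ⊆ (s.filter fun k => 0 - π / 2 ≤ θ k ∧ θ k ≤ 0 + π / 2) ∪
      (s.filter fun k => π - π / 2 ≤ θ k ∧ θ k ≤ π + π / 2) ∪
      (s.filter fun k => 2 * π - π / 2 ≤ θ k ∧ θ k ≤ 2 * π + π / 2) := by
    intro k hk
    have hkL : (k : ℝ) + 1 ≤ L := by
      have := Finset.mem_range.1 (Finset.mem_filter.1 hk).1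
      exact_mod_cast this
    have h0 : 0 ≤ θ k := by simp only [hθ]; positivity
    have h1 : θ k ≤ 2 * π := by
      simp only [hθ]
      rw [div_le_iff₀ hL']
      nlinarith
    simp only [Finset.mem_union, Finset.mem_filter, hk, true_and]
    rcases le_total (θ k) (π / 2) with h | h
    · exact Or.inl (Or.inl ⟨by linarith, by linarith⟩)
    · rcases le_total (θ k) (3 * π / 2) with h' | h'
      · exact Or.inl (Or.inr ⟨by linarith, by linarith⟩)
      · exact Or.inr ⟨by linarith, by linarith⟩
  have hcard := (Finset.card_le_card hcover).trans ((Finset.card_union_le _ _).trans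
    (Nat.add_le_add_right (Finset.card_union_le _ _) _))
  have hcard' : (s.card : ℝ) ≤ _ := Nat.cast_le.2 hcard
  push_cast at hcard'
  have p0 := hpiece 0 sin_zero
  have p1 := hpiece π sin_pi
  have p2 := hpiece (2 * π) sin_two_pi
  linarith

/-- The bound of order `t ^ (-1/3)` (with `t = T ^ 3`) for a lattice Bessel sum. -/
theorem norm_sum_exp_cos_le (n : ℕ) {ν T L : ℝ} (hn : L = n + 1) (hν : |ν| ≤ π) (hT : 1 ≤ T)
    (hTL : 8 * T ^ 3 ≤ L) :
    ‖∑ k ∈ Finset.range (n + 1),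
      Complex.exp (((ν * k + 2 * T ^ 3 * cos (2 * π * k / L) : ℝ) : ℂ) * Complex.I)‖ ≤
      23 * L / T := by
  have hπ := pi_pos
  have hT0 : 0 < T := by linarith
  have hT3 : 1 ≤ T ^ 3 := one_le_pow₀ hT
  have hL : 0 < L := by linarith
  set β : ℝ := 2 * T ^ 3 * sin (π / L) with hβdef
  set θ : ℕ → ℝ := fun k => 2 * π * ((k : ℝ) + 1 / 2) / L with hθ
  have hsin1 : 2 / L ≤ sin (π / L) := by
    have h := mul_le_sin (x := π / L) (by positivity) (by
      rw [div_le_iff₀ hL]; nlinarith)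
    have : 2 / π * (π / L) = 2 / L := by field_simp
    linarith
  have hsin2 : sin (π / L) ≤ π / L := sin_le (by positivity)
  have hβ : 4 * T ^ 3 / L ≤ β := by
    have := mul_le_mul_of_nonneg_left hsin1 (by positivity : 0 ≤ 2 * T ^ 3)
    calc 4 * T ^ 3 / L = 2 * T ^ 3 * (2 / L) := by ring
      _ ≤ β := this
  have hβ0 : 0 < β := lt_of_lt_of_le (by positivity) hβ
  have hβ2 : β ≤ π / 4 := by
    have h1 := mul_le_mul_of_nonneg_left hsin2 (by positivity : 0 ≤ 2 * T ^ 3)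
    have h2 : 2 * T ^ 3 * (π / L) ≤ π / 4 := by
      rw [mul_div_assoc', div_le_iff₀ hL]; nlinarith
    linarith
  set x : ℕ → ℝ := fun k => ν / 2 - β * sin (θ k) with hx
  -- This cutoff makes `1 / a`, from the summation by parts, of the same order `L / T` as the number
  -- of truncated indices.
  set a : ℝ := T / L with ha
  have ha0 : 0 < a := by positivity
  have hTT3 : T ≤ T ^ 3 := le_self_pow₀ hT (by norm_num)
  have ha1 : a ≤ 1 := (div_le_one hL).2 (by linarith)
  have hν2 : |ν / 2| + β ≤ 3 * π / 4 := by
    rw [abs_div, abs_two]; linarith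
  have hxb : ∀ k, |x k| ≤ 3 * π / 4 := by
    intro k
    refine (abs_sub _ _).trans (le_trans ?_ hν2)
    rw [abs_mul, abs_of_pos hβ0]
    have := mul_le_mul_of_nonneg_left (abs_sin_le_one (θ k)) hβ0.le
    linarith
  have hφ : ∀ k : ℕ, (ν * (k + 1 : ℕ) + 2 * T ^ 3 * cos (2 * π * (k + 1 : ℕ) / L)) -
      (ν * k + 2 * T ^ 3 * cos (2 * π * k / L)) = 2 * x k := by
    intro k
    have h1 : cos (2 * π * (k + 1 : ℕ) / L) - cos (2 * π * k / L) =
        -2 * sin (θ k) * sin (π / L) := by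
      rw [cos_sub_cos, show (2 * π * (k + 1 : ℕ) / L + 2 * π * k / L) / 2 = θ k by
        simp only [hθ]; push_cast; ring,
        show (2 * π * (k + 1 : ℕ) / L - 2 * π * k / L) / 2 = π / L by
        push_cast; ring]
    have h2 : 2 * x k = ν + 2 * T ^ 3 * (-2 * sin (θ k) * sin (π / L)) := by
      simp only [hx, hβdef]; ring
    rw [h2, ← h1]
    push_cast; ring
  have hvar : ∑ k ∈ Finset.range n, |truncCot a (x (k + 1)) - truncCot a (x k)| ≤ 18 / a := by
    have hmono : MonotoneOn θ (Iic n) := fun k _ l _ hkl => by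
      have : (k : ℝ) ≤ l := by exact_mod_cast hkl
      simp only [hθ]; gcongr
    have hmem : ∀ k ≤ n, θ k ∈ Icc 0 (2 * π) := by
      intro k hk
      have : (k : ℝ) ≤ n := by exact_mod_cast hk
      refine ⟨by simp only [hθ]; positivity, ?_⟩
      simp only [hθ]
      rw [div_le_iff₀ hL]
      nlinarith
    have h1 := eVariationOn.sum_le_of_monotoneOn_Iic
      (f := fun θ => truncCot a (ν / 2 - β * sin θ)) hmono hmem
    have h2 := h1.trans ((eVariationOn_comp_sub_mul_sin_le (truncCot a) hβ0.le hν2).trans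
      (mul_le_mul_right (eVariationOn_truncCot_le ha0 ha1) 3))
    simp only [edist_dist, Real.dist_eq] at h2
    rw [← ENNReal.ofReal_sum_of_nonneg (fun _ _ => abs_nonneg _),
      show (3 : ENNReal) = ENNReal.ofReal 3 by simp, ← ENNReal.ofReal_mul (by norm_num),
      ENNReal.ofReal_le_ofReal_iff (by positivity)] at h2
    calc _ ≤ 3 * (6 / a) := h2
      _ = 18 / a := by ring
  have hmain := norm_sum_exp_le (fun k => ν * k + 2 * T ^ 3 * cos (2 * π * k / L)) x hφ
    ha0 ha1 hxb n hvar
  -- The value `ε = 1 / (2 T)` solves `(4 T ^ 3 / L) ε ^ 2 = a`, and `β ≥ 4 T ^ 3 / L`.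
  have hcount := card_abs_sub_mul_sin_lt_le (n + 1) n.succ_pos (α := ν / 2) (β := β) (a := a)
    (ε := 1 / (2 * T)) hβ0 (by positivity) (by
      calc a = 4 * T ^ 3 / L * (1 / (2 * T)) ^ 2 := by rw [ha]; field_simp; norm_num
        _ ≤ _ := by gcongr)
  have hcast : ((n + 1 : ℕ) : ℝ) = L := by rw [hn]; push_cast; rfl
  rw [hcast] at hcount
  refine hmain.trans ?_
  have h3 : 2 / a + 18 / a / 2 = 11 * (L / T) := by rw [ha]; field_simp; norm_num
  have h4 : 1 ≤ L / T := (le_div_iff₀ hT0).2 (by linarith)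
  have h5 : L * (1 / (2 * T)) / 2 = L / T / 4 := by field_simp; norm_num
  rw [h5] at hcount
  have h6 : 23 * L / T = 23 * (L / T) := by ring
  rw [h6]
  have h7 : (((Finset.range (n + 1)).filter fun k => |x k| < a).card : ℝ) ≤ 3 * (L / T / 4 + 1) :=
    hcount
  -- In units of `L / T ≥ 1`, the total is at most `9 (1/4 + 1) + 11 ≤ 23`.
  linarith

end ExponentialSum
end

noncomputable section
namespace FermionHopping

/-! ### Diagonalisation by plane waves. -/

section Diagonalisation

/-- The plane wave `exp (2 π i a k / L)`. -/
def planeWave {L : ℕ} (a k : Fin L) : ℂ :=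
  Complex.exp (2 * Real.pi * Complex.I / L) ^ ((a : ℕ) * (k : ℕ))

/-- The eigenvalue `-2 cos (2 π k / L)` of the one-dimensional hopping matrix. -/
def dispersion {L : ℕ} (k : Fin L) : ℂ := ((-(2 * Real.cos (2 * Real.pi * (k : ℕ) / L)) : ℝ) : ℂ)

lemma exp_two_pi_div_pow (L m : ℕ) :
    Complex.exp (2 * Real.pi * Complex.I / L) ^ m =
      Complex.exp (((2 * Real.pi * m / L : ℝ) : ℂ) * Complex.I) := by
  rw [← Complex.exp_nat_mul]
  push_cast
  ring_nf

lemma planeWave_add_one {L : ℕ} [NeZero L] (a k : Fin L) :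
    planeWave (a + 1) k = planeWave a k * Complex.exp (2 * Real.pi * Complex.I / L) ^ (k : ℕ) := by
  have h1 := (Complex.isPrimitiveRoot_exp L (NeZero.ne L)).pow_eq_one
  unfold planeWave
  generalize Complex.exp (2 * Real.pi * Complex.I / L) = ζ at h1 ⊢
  have h2 : ζ ^ ((a + 1 : Fin L) : ℕ) = ζ ^ ((a : ℕ) + 1) := by
    rw [Fin.val_add, ← pow_mod_orderOf, Nat.mod_mod_of_dvd _ (orderOf_dvd_of_pow_eq_one h1),
      pow_mod_orderOf, pow_add, pow_add]
    congr 1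
    rw [Fin.val_one', ← pow_mod_orderOf, Nat.mod_mod_of_dvd _ (orderOf_dvd_of_pow_eq_one h1),
      pow_mod_orderOf]
  rw [pow_mul, h2, ← pow_mul, add_mul, one_mul, pow_add]

lemma sum_hopping1D_mul {L : ℕ} [NeZero L] (hL : 3 ≤ L) (a : Fin L) (f : Fin L → ℂ) :
    ∑ b, (hopping1D L a b : ℂ) * f b = -(f (a + 1) + f (a - 1)) := by
  have hone : ((1 : Fin L) : ℕ) = 1 := by rw [Fin.val_one', Nat.mod_eq_of_lt (by omega)]
  have hval : ∀ x y : Fin L, ((x : ℕ) = ((y : ℕ) + 1) % L) ↔ x = y + 1 := by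
    intro x y
    rw [Fin.ext_iff, Fin.val_add, hone]
  -- This is where `L ≥ 3` matters: for `L = 2` the two neighbours coincide and the matrix entry
  -- counts them once.
  have hne : a + 1 ≠ a - 1 := by
    intro h
    have h2 : (1 : Fin L) + 1 = 0 := by
      have := congrArg (fun z => z - a + 1) h
      simpa using this
    have h3 := congrArg Fin.val h2
    rw [Fin.val_add, hone, Nat.mod_eq_of_lt (by omega)] at h3
    simp at h3
  have hterm : ∀ b, (hopping1D L a b : ℂ) * f b =
      (if b = a + 1 then -f b else 0) + (if b = a - 1 then -f b else 0) := by
    intro b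
    have h1 : (a = b + 1) ↔ (b = a - 1) := by
      rw [eq_sub_iff_add_eq, eq_comm]
    simp only [hopping1D, Matrix.of_apply, hval, h1]
    by_cases hb : b = a + 1
    · simp [hb, hne]
    · by_cases hb' : b = a - 1 <;> simp [hb, hb', hne.symm]
  simp only [hterm, Finset.sum_add_distrib, Finset.sum_ite_eq', Finset.mem_univ, if_true]
  ring

lemma sum_hopping1D_mul_planeWave {L : ℕ} (hL : 3 ≤ L) (a k : Fin L) :
    ∑ b, (hopping1D L a b : ℂ) * planeWave b k = dispersion k * planeWave a k := by
  have : NeZero L := ⟨by omega⟩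
  rw [sum_hopping1D_mul hL]
  have h2 := planeWave_add_one (a - 1) k
  rw [sub_add_cancel] at h2
  have h3 : planeWave (a - 1) k = planeWave a k *
      Complex.exp (-((2 * Real.pi * (k : ℕ) / L : ℝ) : ℂ) * Complex.I) := by
    rw [h2, exp_two_pi_div_pow, mul_assoc, ← Complex.exp_add, neg_mul, add_neg_cancel,
      Complex.exp_zero, mul_one]
  rw [planeWave_add_one, h3, exp_two_pi_div_pow, dispersion]
  have h4 := Complex.two_cos ((2 * Real.pi * (k : ℕ) / L : ℝ) : ℂ)
  rw [Complex.ofReal_neg, Complex.ofReal_mul, Complex.ofReal_cos, Complex.ofReal_ofNat, h4]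
  ring

lemma planeWave_mul_star {L : ℕ} (a b k : Fin L) :
    planeWave a k * star (planeWave b k) =
      Complex.exp (((2 * Real.pi * (((a : ℕ) : ℝ) - (b : ℕ)) / L * (k : ℕ) : ℝ) : ℂ) *
        Complex.I) := by
  rw [planeWave, planeWave, exp_two_pi_div_pow, exp_two_pi_div_pow, Complex.star_def,
    ← Complex.exp_conj, ← Complex.exp_add, map_mul, Complex.conj_I, Complex.conj_ofReal]
  push_cast
  ring_nf

lemma sum_planeWave_mul_star {L : ℕ} (a b : Fin L) :
    ∑ k, planeWave a k * star (planeWave b k) = if a = b then (L : ℂ) else 0 := by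
  have hL : L ≠ 0 := by have := a.2; omega
  have hζ := Complex.isPrimitiveRoot_exp L hL
  have hterm : ∀ k : Fin L, planeWave a k * star (planeWave b k) =
      (Complex.exp (2 * Real.pi * Complex.I / L) ^ (a : ℕ) *
        (Complex.exp (2 * Real.pi * Complex.I / L) ^ (b : ℕ))⁻¹) ^ (k : ℕ) := by
    intro k
    rw [planeWave_mul_star, exp_two_pi_div_pow, exp_two_pi_div_pow, ← Complex.exp_neg,
      ← Complex.exp_add, ← Complex.exp_nat_mul]
    push_cast
    ring_nf
  simp only [hterm]
  generalize Complex.exp (2 * Real.pi * Complex.I / L) = ζ at hζ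
  have hζ0 : ζ ≠ 0 := hζ.ne_zero hL
  rw [Fin.sum_univ_eq_sum_range (fun k => (ζ ^ (a : ℕ) * (ζ ^ (b : ℕ))⁻¹) ^ k)]
  split_ifs with hab
  · subst hab
    simp [mul_inv_cancel₀ (pow_ne_zero _ hζ0)]
  · have hq : ζ ^ (a : ℕ) * (ζ ^ (b : ℕ))⁻¹ ≠ 1 := by
      intro h
      rw [mul_inv_eq_one₀ (pow_ne_zero _ hζ0)] at h
      exact hab (Fin.ext (hζ.pow_inj a.2 b.2 h))
    rw [geom_sum_eq hq, mul_pow, inv_pow, pow_right_comm, hζ.pow_eq_one,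
      pow_right_comm, hζ.pow_eq_one]
    simp

variable {d L : ℕ}

/-- The matrix of `d`-dimensional plane waves. -/
def planeWaveMatrix (d L : ℕ) : Matrix (Site d L) (Site d L) ℂ :=
  Matrix.of fun r k => ∏ i, planeWave (r i) (k i)

lemma planeWaveMatrix_mul_conjTranspose (hL : L ≠ 0) :
    planeWaveMatrix d L * (((L : ℂ) ^ d)⁻¹ • (planeWaveMatrix d L)ᴴ) = 1 := by
  ext r s
  rw [Matrix.mul_smul, Matrix.smul_apply, Matrix.mul_apply]
  simp only [Matrix.conjTranspose_apply, planeWaveMatrix, Matrix.of_apply, star_prod,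
    ← Finset.prod_mul_distrib]
  have h := Finset.prod_univ_sum (fun _ : Fin d => (Finset.univ : Finset (Fin L)))
    (fun i κ => planeWave (r i) κ * star (planeWave (s i) κ))
  rw [Fintype.piFinset_univ] at h
  rw [← h]
  simp only [sum_planeWave_mul_star]
  have hL' : (L : ℂ) ≠ 0 := Nat.cast_ne_zero.2 hL
  by_cases hrs : r = s
  · subst hrs
    simp [hL']
  · obtain ⟨i, hi⟩ := Function.ne_iff.1 hrs
    rw [Finset.prod_eq_zero (Finset.mem_univ i) (if_neg hi), smul_zero, Matrix.one_apply_ne hrs]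

lemma hopping_mul_planeWaveMatrix (hL : 3 ≤ L) :
    (hopping d L).map Complex.ofReal * planeWaveMatrix d L =
      planeWaveMatrix d L * Matrix.diagonal fun k => ∑ i, dispersion (k i) := by
  ext r k
  rw [Matrix.mul_diagonal, Matrix.mul_apply]
  simp only [hopping, Matrix.map_apply, Matrix.of_apply, Complex.ofReal_sum, Finset.sum_mul,
    Finset.mul_sum, planeWaveMatrix]
  rw [Finset.sum_comm]
  refine Finset.sum_congr rfl fun i _ => ?_
  have hterm : ∀ s : Site d L, ((hopping1D L (r i) (s i) *
      ∏ l ∈ Finset.univ.erase i, (1 : Matrix (Fin L) (Fin L) ℝ) (r l) (s l) : ℝ) : ℂ) *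
      ∏ l, planeWave (s l) (k l) =
      ∏ l, ((if l = i then (hopping1D L (r l) (s l) : ℂ) else
        (1 : Matrix (Fin L) (Fin L) ℂ) (r l) (s l)) * planeWave (s l) (k l)) := by
    intro s
    rw [Finset.prod_mul_distrib]
    congr 1
    rw [← Finset.mul_prod_erase _ _ (Finset.mem_univ i), if_pos rfl, Complex.ofReal_mul,
      Complex.ofReal_prod]
    congr 1
    refine Finset.prod_congr rfl fun l hl => ?_
    rw [if_neg (Finset.ne_of_mem_erase hl), Matrix.one_apply, Matrix.one_apply]
    split_ifs <;> simp
  simp only [hterm]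
  -- The sum over sites of a product over directions is the product of one-dimensional sums; only
  -- direction `i` contributes an eigenvalue.
  have h := Finset.prod_univ_sum (fun _ : Fin d => (Finset.univ : Finset (Fin L)))
    (fun l b => (if l = i then (hopping1D L (r l) b : ℂ) else
        (1 : Matrix (Fin L) (Fin L) ℂ) (r l) b) * planeWave b (k l))
  rw [Fintype.piFinset_univ] at h
  rw [← h]
  have hfac : ∀ l, ∑ b, (if l = i then (hopping1D L (r l) b : ℂ) else
      (1 : Matrix (Fin L) (Fin L) ℂ) (r l) b) * planeWave b (k l) =
      (if l = i then dispersion (k l) else 1) * planeWave (r l) (k l) := by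
    intro l
    split_ifs with hl
    · exact sum_hopping1D_mul_planeWave hL _ _
    · simp [Matrix.one_apply]
  simp only [hfac, Finset.prod_mul_distrib]
  rw [Finset.prod_ite_eq' Finset.univ i (fun l => dispersion (k l)), if_pos (Finset.mem_univ i),
    mul_comm]

/-- The unnormalised one-dimensional kernel of `exp (z M⁽¹⁾)` in terms of plane waves. -/
def waveKernel (z : ℂ) (a b : Fin L) : ℂ :=
  ∑ k : Fin L, planeWave a k * Complex.exp (z * dispersion k) * star (planeWave b k)

theorem exp_smul_hopping_apply (hL : 3 ≤ L) (z : ℂ) (r s : Site d L) :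
    NormedSpace.exp (z • (hopping d L).map Complex.ofReal) r s =
      ∏ i, (waveKernel z (r i) (s i) / L) := by
  have hL0 : L ≠ 0 := by omega
  have hinv := planeWaveMatrix_mul_conjTranspose (d := d) hL0
  have hunit : IsUnit (planeWaveMatrix d L) :=
    (Matrix.isUnit_iff_isUnit_det _).2 (Matrix.isUnit_det_of_right_inverse hinv)
  have hinv' := Matrix.inv_eq_right_inv hinv
  have hM : z • (hopping d L).map Complex.ofReal = planeWaveMatrix d L *
      (Matrix.diagonal fun k => z * ∑ i, dispersion (k i)) * (planeWaveMatrix d L)⁻¹ := by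
    have : (Matrix.diagonal fun k : Site d L => z * ∑ i, dispersion (k i)) =
        z • Matrix.diagonal fun k : Site d L => ∑ i, dispersion (k i) := by
      rw [← Matrix.diagonal_smul]; rfl
    rw [this, Matrix.mul_smul, ← hopping_mul_planeWaveMatrix hL, Matrix.smul_mul, Matrix.mul_assoc,
      hinv', hinv, Matrix.mul_one]
  rw [hM, Matrix.exp_conj _ _ hunit, Matrix.exp_diagonal, hinv', Matrix.mul_smul,
    Matrix.smul_apply, Matrix.mul_apply, Finset.prod_div_distrib, Finset.prod_const,
    Finset.card_univ, Fintype.card_fin, smul_eq_mul, inv_mul_eq_div]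
  congr 1
  unfold waveKernel
  rw [Finset.prod_univ_sum, Fintype.piFinset_univ]
  refine Finset.sum_congr rfl fun k _ => ?_
  rw [Matrix.mul_diagonal, Pi.coe_exp, ← Complex.exp_eq_exp_ℂ, Matrix.conjTranspose_apply,
    planeWaveMatrix, Matrix.of_apply, Matrix.of_apply, star_prod, Finset.mul_sum, Complex.exp_sum,
    ← Finset.prod_mul_distrib, ← Finset.prod_mul_distrib]

end Diagonalisation

/-! ### Decay of the propagator. -/

section Bound

variable {L : ℕ}

lemma norm_waveKernel_neg_le {T : ℝ} (hT : 1 ≤ T) (hTL : 8 * T ^ 3 ≤ L) (a b : Fin L) :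
    ‖waveKernel (-(Complex.I * ((T ^ 3 : ℝ) : ℂ))) a b‖ ≤ 23 * L / T := by
  obtain ⟨n, rfl⟩ : ∃ n, L = n + 1 := ⟨L - 1, by have := a.2; omega⟩
  have hπ := Real.pi_pos
  have hL0 : (0 : ℝ) < ((n + 1 : ℕ) : ℝ) := by positivity
  have ha : ((a : ℕ) : ℝ) < ((n + 1 : ℕ) : ℝ) := by exact_mod_cast a.2
  have hb : ((b : ℕ) : ℝ) < ((n + 1 : ℕ) : ℝ) := by exact_mod_cast b.2
  have ha0 : (0 : ℝ) ≤ ((a : ℕ) : ℝ) := Nat.cast_nonneg _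
  have hb0 : (0 : ℝ) ≤ ((b : ℕ) : ℝ) := Nat.cast_nonneg _
  -- Changing the frequency by `2 π m` is invisible at integer `k`, so it can be brought into `[-π,
  -- π]`, as the exponential sum bound requires.
  obtain ⟨m, hm⟩ : ∃ m : ℤ, |2 * Real.pi * (((a : ℕ) : ℝ) - (b : ℕ)) / ((n + 1 : ℕ) : ℝ) -
      2 * Real.pi * m| ≤ Real.pi := by
    set q := (((a : ℕ) : ℝ) - (b : ℕ)) / ((n + 1 : ℕ) : ℝ) with hq
    refine ⟨round q, ?_⟩
    have h1 := abs_sub_round q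
    have h2 : 2 * Real.pi * (((a : ℕ) : ℝ) - (b : ℕ)) / ((n + 1 : ℕ) : ℝ) -
      2 * Real.pi * round q = 2 * Real.pi * (q - round q) := by rw [hq]; ring
    rw [h2, abs_mul, abs_of_pos (by positivity)]
    nlinarith
  have h := norm_sum_exp_cos_le n (L := ((n + 1 : ℕ) : ℝ)) (by push_cast; rfl) hm hT hTL
  refine le_of_eq_of_le ?_ h
  congr 1
  rw [← Fin.sum_univ_eq_sum_range (fun k => Complex.exp (((_ * (k : ℝ) + 2 * T ^ 3 *
    Real.cos (2 * Real.pi * k / ((n + 1 : ℕ) : ℝ)) : ℝ) : ℂ) * Complex.I))]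
  unfold waveKernel
  refine Finset.sum_congr rfl fun k _ => ?_
  rw [mul_right_comm, planeWave_mul_star, ← Complex.exp_add, dispersion]
  refine Complex.exp_eq_exp_iff_exists_int.2 ⟨m * (k : ℕ), ?_⟩
  push_cast
  ring

/-- The dispersion is real, so conjugation reverses time. This transfers the bound from the
annihilation block to the creation block. -/
lemma waveKernel_star (t : ℝ) (a b : Fin L) :
    waveKernel (Complex.I * (t : ℂ)) a b = star (waveKernel (-(Complex.I * (t : ℂ))) b a) := by
  unfold waveKernel
  rw [star_sum]
  refine Finset.sum_congr rfl fun k _ => ?_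
  rw [star_mul, star_mul, star_star, ← mul_assoc]
  congr 2
  rw [Complex.star_def, ← Complex.exp_conj, dispersion, map_mul, map_neg, map_mul, Complex.conj_I,
    Complex.conj_ofReal, Complex.conj_ofReal, neg_mul, neg_mul, neg_mul, neg_neg]

lemma norm_exp_hopping_le {d : ℕ} {T : ℝ} {z : ℂ} (hL : 3 ≤ L) (hT : 1 ≤ T)
    (hTL : 8 * T ^ 3 ≤ L)
    (hz : z = -(Complex.I * ((T ^ 3 : ℝ) : ℂ)) ∨ z = Complex.I * ((T ^ 3 : ℝ) : ℂ))
    (r s : Site d L) :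
    ‖NormedSpace.exp (z • (hopping d L).map Complex.ofReal) r s‖ ≤ (23 / T) ^ d := by
  rw [exp_smul_hopping_apply hL, norm_prod]
  have hL0 : (0 : ℝ) < L := by exact_mod_cast (by omega : 0 < L)
  have hk : ∀ a b : Fin L, ‖waveKernel z a b / L‖ ≤ 23 / T := by
    intro a b
    rw [norm_div, Complex.norm_natCast, div_le_iff₀ hL0, div_mul_eq_mul_div]
    rcases hz with rfl | rfl
    · exact norm_waveKernel_neg_le hT hTL a b
    · rw [waveKernel_star, norm_star]
      exact norm_waveKernel_neg_le hT hTL b a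
  calc _ ≤ ∏ _i : Fin d, 23 / T := Finset.prod_le_prod (fun _ _ => norm_nonneg _) fun i _ => hk _ _
    _ = (23 / T) ^ d := by rw [Finset.prod_const, Finset.card_univ, Fintype.card_fin]

theorem norm_propagator_le {d : ℕ} {T : ℝ} (hL : 3 ≤ L) (hT : 1 ≤ T) (hTL : 8 * T ^ 3 ≤ L)
    (j k : ModeIndex d L) : ‖propagator d L (T ^ 3) j k‖ ≤ (23 / T) ^ d := by
  rw [propagator_apply]
  split_ifs with h1 h2
  · exact norm_exp_hopping_le hL hT hTL (Or.inl rfl) _ _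
  · exact norm_exp_hopping_le hL hT hTL (Or.inr rfl) _ _
  · rw [norm_zero]; positivity

end Bound

end FermionHopping
end

/-! ### Assembly and choice of the constant. -/

theorem mainTheorem3 (d : ℕ) (hd : 1 ≤ d) :
    ∃ C : ℝ, 0 < C ∧ ∀ L : ℕ, 0 < L → Even L → ∀ V : ℕ, V = L ^ d →
      (∀ (t : ℝ) (j : FermionHopping.ModeIndex d L),
        FermionHopping.heisenberg t (FermionHopping.modeOp j) =
          ∑ k : FermionHopping.ModeIndex d L,
            FermionHopping.propagator d L t j k • FermionHopping.modeOp k) ∧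
      (FermionHopping.hamiltonian d L =
          ∑ j : FermionHopping.ModeIndex d L, ∑ k : FermionHopping.ModeIndex d L,
            FermionHopping.coupling d L j k •
              ((FermionHopping.modeOp j).conjTranspose * FermionHopping.modeOp k)) ∧
      ∀ t : ℝ, 0 < t → t ≤ (V : ℝ) ^ ((6 : ℝ) / (7 * (d : ℝ))) →
        ∀ j k : FermionHopping.ModeIndex d L,
          ‖FermionHopping.propagator d L t j k‖ ≤ C * t ^ (-((d : ℝ) / 3)) := by
  -- The first summand serves the dispersive regime `L ≥ 8 ^ 7`, `t ≥ 1`, and also `t < 1`. The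
  -- second makes the unitarity bound enough when `L < 8 ^ 7` and `t ≥ 1`, since then `T ≤ t ≤ L ≤ 8
  -- ^ 7`.
  refine ⟨23 ^ d + ((8 : ℝ) ^ 7) ^ d, by positivity, ?_⟩
  rintro L hL0 ⟨m, hm⟩ V rfl
  have hL2 : 2 ≤ L := by omega
  refine ⟨FermionHopping.heisenberg_modeOp, FermionHopping.hamiltonian_eq_sum_coupling hL2, ?_⟩
  intro t ht htV j k
  have hLR : (2 : ℝ) ≤ L := by exact_mod_cast hL2
  have hd0 : (0 : ℝ) < d := by exact_mod_cast hd
  have htL : t ≤ (L : ℝ) ^ ((6 : ℝ) / 7) := by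
    rwa [Nat.cast_pow, ← Real.rpow_natCast, ← Real.rpow_mul (by linarith),
      show (d : ℝ) * (6 / (7 * d)) = 6 / 7 by field_simp] at htV
  set T : ℝ := t ^ ((1 : ℝ) / 3) with hTdef
  have hT0 : 0 < T := Real.rpow_pos_of_pos ht _
  have hT3 : T ^ 3 = t := by
    rw [hTdef, ← Real.rpow_natCast, ← Real.rpow_mul ht.le]; norm_num
  have hTd : t ^ (-((d : ℝ) / 3)) = (1 / T) ^ d := by
    rw [Real.rpow_neg ht.le, one_div, inv_pow, hTdef, ← Real.rpow_natCast, ← Real.rpow_mul ht.le]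
    congr 2; ring
  rw [hTd]
  have hpos : (0 : ℝ) ≤ (1 / T) ^ d := by positivity
  rcases lt_or_ge t 1 with ht1 | ht1
  · have hT1 : T ≤ 1 := Real.rpow_le_one ht.le ht1.le (by norm_num)
    have h1 : (1 : ℝ) ≤ (1 / T) ^ d := one_le_pow₀ ((le_div_iff₀ hT0).2 (by linarith))
    have h2 : (1 : ℝ) ≤ 23 ^ d := one_le_pow₀ (by norm_num)
    have h3 : (0 : ℝ) ≤ ((8 : ℝ) ^ 7) ^ d := by positivity
    refine (FermionHopping.norm_propagator_le_one t j k).trans ?_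
    exact one_le_mul_of_one_le_of_one_le (by linarith) h1
  have hT1 : 1 ≤ T := Real.one_le_rpow ht1 (by norm_num)
  rcases lt_or_ge L (8 ^ 7) with hLs | hLl
  · have hLs' : (L : ℝ) ≤ 8 ^ 7 := by exact_mod_cast hLs.le
    have htL' : t ≤ L := htL.trans (by
      calc (L : ℝ) ^ ((6 : ℝ) / 7) ≤ (L : ℝ) ^ (1 : ℝ) :=
            Real.rpow_le_rpow_of_exponent_le (by linarith) (by norm_num)
        _ = L := Real.rpow_one _)
    have hTt : T ≤ 8 ^ 7 := by
      have := le_self_pow₀ hT1 (n := 3) (by norm_num)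
      linarith
    refine (FermionHopping.norm_propagator_le_one t j k).trans ?_
    have h1 : (1 : ℝ) ≤ ((8 : ℝ) ^ 7) ^ d * (1 / T) ^ d := by
      rw [← mul_pow]
      exact one_le_pow₀ (by rw [mul_one_div]; exact (le_div_iff₀ hT0).2 (by linarith))
    have h2 : 0 ≤ (23 : ℝ) ^ d * (1 / T) ^ d := by positivity
    linarith
  · have hLl' : (8 : ℝ) ^ 7 ≤ L := by exact_mod_cast hLl
    -- The spare power `L ^ (1/7)` left by `t ≤ L ^ (6/7)` absorbs the factor `8`; this fixes the
    -- threshold `8 ^ 7`.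
    have h8 : (8 : ℝ) ≤ (L : ℝ) ^ ((1 : ℝ) / 7) := by
      have := Real.rpow_le_rpow (by positivity) hLl' (by norm_num : (0 : ℝ) ≤ 1 / 7)
      rwa [← Real.rpow_natCast, ← Real.rpow_mul (by norm_num),
        show ((7 : ℕ) : ℝ) * (1 / 7) = 1 by norm_num, Real.rpow_one] at this
    have hTL : 8 * T ^ 3 ≤ L := by
      rw [hT3]
      calc 8 * t ≤ (L : ℝ) ^ ((1 : ℝ) / 7) * (L : ℝ) ^ ((6 : ℝ) / 7) := by gcongr
        _ = L := by
          rw [← Real.rpow_add (by linarith)]; norm_num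
    have := FermionHopping.norm_propagator_le (by omega) hT1 hTL j k
    rw [hT3] at this
    refine this.trans ?_
    have h3 : (0 : ℝ) ≤ ((8 : ℝ) ^ 7) ^ d * (1 / T) ^ d := by positivity
    have h4 : (23 / T) ^ d = (23 : ℝ) ^ d * (1 / T) ^ d := by rw [← mul_pow, mul_one_div]
    linarith
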